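/- A \emph{tract} is a commutative multiplicative monoid $F$ with an absorbing element $0$ such that $F^\times = F\setminus\{0\}$ is a group, together with a null set $N_F\subseteq\mathbb{N}[F^\times]$ (a subset of the group semiring) that contains $0$, is closed under multiplication by elements of $F^\times$, and is such that there is a unique $\epsilon\in F^\times$ with $1+\epsilon\in N_F$. A homomorphism of tracts $\varphi:F'\to F$ is a map with $\varphi(0)=0$ that induces a group homomorphism $(F')^\times\to F^\times$ and satisfies $\varphi(N_{F'})\subseteq N_F$. A field $K$ is a tract, with $N_K$ the set of formal sums $\sum x_i$ of units whose value in $K$ is $0$. The \emph{sign hyperfield} $\mathbb{S}=\mathbb{R}/\mathbb{R}_{>0}=\{0,1,-1\}$ is the tract whose null set consists of the formal sums $\sum_i x_i$ with $x_i\in\{1,-1\}$ for which there are real $c_i>0$ with $\sum_i c_i x_i=0$; the natural homomorphism of tracts $\mathrm{sign}:\mathbb{R}\to\mathbb{S}$ sends a real number to its sign. For a finite set $E$ and $X,Y\in F^E$ write $X\perp Y$ if $\sum_{e\in E} X_eY_e\in N_F$ (zero terms being omitted). An \emph{$F$-matroid} $M$ on $E$ is a matroid $\underline M$ on $E$ with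 sets $\mathcal{C}(M),\mathcal{C}^*(M)\subseteq F^E$ of $F$-circuits and $F$-cocircuits, both closed under multiplication by $F^\times$, such that the support of each $F$-circuit (resp. $F$-cocircuit) is a circuit (resp. cocircuit) of $\underline M$, each circuit (resp. cocircuit) of $\underline M$ is the support of an $F$-circuit (resp. $F$-cocircuit) that is unique up to multiplication by an element of $F^\times$, and $C\perp C^*$ for all $C\in\mathcal{C}(M)$, $C^*\in\mathcal{C}^*(M)$. An $\mathbb{S}$-matroid is the same thing as an oriented matroid. The \emph{vectors} (resp. \emph{covectors}) of $M$ are the $X\in F^E$ with $X\perp C^*$ for every $F$-cocircuit $C^*$ (resp. $X\perp C$ for every $F$-circuit $C$). For a homomorphism of tracts $\varphi:F'\to F$ and an $F'$-matroid $M'$, the \emph{push-forward} $\varphi_*(M')$ is the $F$-matroid with the same underlying matroid, whose $F$-circuits (resp. $F$-cocircuits) are all $c\,\varphi(X)$ with $c\in F^\times$ and $X$ an $F'$-circuit (resp. $F'$-cocircuit) of $M'$. The homomorphism $\varphi$ is \emph{epic} if for every $F'$-matroid $M'$ (on any finite set) the natural map $X\mapsto\varphi(X)$ from the vectors of $M'$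 to the vectors of $\varphi_*(M')$ is surjective. \textbf{Proposition.} The natural map $\mathrm{sign}:\mathbb{R}\to\mathbb{S}$ is epic. Moreover, for every $\mathbb{R}$-matroid $M$ on a finite set $E$ and every covector $Y$ of the oriented matroid $\mathrm{sign}_*(M)$, there is a covector $X$ of $M$ with $Y_e=\mathrm{sign}(X_e)$ for all $e\in E$. -/

import Mathlib

universe u

/-- A tract structure on a commutative multiplicative monoid `F` with absorbing element `0` such
that `F \ {0}` is a group: a null set in the group semiring `ℕ[Fˣ]` satisfying (T1), (T2), (T3).
The product with `MonoidAlgebra.single g 1` is the natural action of `g : Fˣ` on `ℕ[Fˣ]`. -/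
class Tract (F : Type*) [CommGroupWithZero F] where
  nullSet : Set (MonoidAlgebra ℕ Fˣ)
  zero_mem : 0 ∈ nullSet
  existsUnique_neg_one :
    ∃! ε : Fˣ, MonoidAlgebra.single (1 : Fˣ) (1 : ℕ) + MonoidAlgebra.single ε 1 ∈ nullSet
  single_mul_mem : ∀ (g : Fˣ), ∀ s ∈ nullSet, MonoidAlgebra.single g (1 : ℕ) * s ∈ nullSet

/-- The map `ℕ[Gˣ] → ℕ[Fˣ]` induced by a homomorphism of groups with zero. -/
noncomputable def mapFormalSums {G F : Type*} [CommGroupWithZero G] [CommGroupWithZero F]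
    (φ : G →*₀ F) : MonoidAlgebra ℕ Gˣ →+* MonoidAlgebra ℕ Fˣ :=
  MonoidAlgebra.mapDomainRingHom ℕ (Units.map (φ : G →* F))

theorem mapFormalSums_single {G F : Type*} [CommGroupWithZero G] [CommGroupWithZero F]
    (φ : G →*₀ F) (g : Gˣ) (n : ℕ) :
    mapFormalSums φ (MonoidAlgebra.single g n)
      = MonoidAlgebra.single (Units.map (φ : G →* F) g) n := by
  simp [mapFormalSums]

/-- The value in a field `K` of a formal sum of units of `K`. -/
noncomputable def formalEval (K : Type*) [Field K] : MonoidAlgebra ℕ Kˣ →+* K :=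
  (MonoidAlgebra.lift ℕ K Kˣ (Units.coeHom K)).toRingHom

theorem formalEval_single {K : Type*} [Field K] (g : Kˣ) (n : ℕ) :
    formalEval K (MonoidAlgebra.single g n) = n * (g : K) := by
  simp [formalEval, MonoidAlgebra.lift_single]

/-- A field as a tract: the null set consists of the formal sums of units whose sum in `K`
is zero. -/
instance Tract.ofField (K : Type*) [Field K] : Tract K where
  nullSet := {s | formalEval K s = 0}
  zero_mem := by simp
  existsUnique_neg_one := by
    refine ⟨-1, ?_, ?_⟩
    · simp [formalEval_single]
    · intro y hy
      simp only [Set.mem_ofPred_eq, map_add, formalEval_single] at hy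
      ext
      simp only [Nat.cast_one, Units.val_one, one_mul] at hy
      rw [Units.val_neg, Units.val_one]
      linear_combination hy
  single_mul_mem := by
    intro g s hs
    simp only [Set.mem_ofPred_eq] at hs ⊢
    rw [map_mul, hs, mul_zero]

/-- Every element of `ℕ[G]` is a finite sum of elements of `G`, repetitions allowed. -/
theorem exists_multiset_formalSum {G : Type*} [Group G] (s : MonoidAlgebra ℕ G) :
    ∃ m : Multiset G, s = (m.map fun g => MonoidAlgebra.single g (1 : ℕ)).sum := by
  induction s using MonoidAlgebra.induction_linear with
  | zero => exact ⟨0, by simp⟩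
  | add x y hx hy =>
    obtain ⟨m, rfl⟩ := hx
    obtain ⟨k, rfl⟩ := hy
    exact ⟨m + k, by simp⟩
  | single g r =>
    refine ⟨Multiset.replicate r g, ?_⟩
    simp

/-- The number of terms of a formal sum. -/
noncomputable def formalLength (G : Type*) [Group G] : MonoidAlgebra ℕ G →+* ℕ :=
  (MonoidAlgebra.lift ℕ ℕ G (1 : G →* ℕ)).toRingHom

theorem formalLength_single {G : Type*} [Group G] (g : G) (n : ℕ) :
    formalLength G (MonoidAlgebra.single g n) = n := by
  simp [formalLength, MonoidAlgebra.lift_single]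

/-- The quotient hyperfield `F = K / H` of a field `K` by a multiplicative subgroup `H` of `Kˣ`.
The quotient map is given as a surjective homomorphism `φ : K → F` of monoids with zero,
whose kernel on units is `H` and which identifies `F` with `(Kˣ / H) ∪ {0}`. The formal sums
`∑ φ(xᵢ)` for which there are `cᵢ ∈ H` with `∑ cᵢ xᵢ = 0` are exactly the images of the formal
sums over `Kˣ` whose value in `K` is zero. -/
@[reducible] noncomputable def Tract.quotientHyperfield {K F : Type*} [Field K]
    [CommGroupWithZero F] (φ : K →*₀ F) (hφ : Function.Surjective φ) : Tract F where
  nullSet := mapFormalSums φ '' {s | formalEval K s = 0}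
  zero_mem := ⟨0, by simp, by simp⟩
  existsUnique_neg_one := by
    refine ⟨Units.map (φ : K →* F) (-1), ?_, ?_⟩
    · exact ⟨MonoidAlgebra.single 1 1 + MonoidAlgebra.single (-1) 1,
        by simp [formalEval_single], by simp [mapFormalSums_single]⟩
    · rintro ε ⟨s, hs, hsε⟩
      obtain ⟨m, rfl⟩ := exists_multiset_formalSum s
      have hm : m.card = 2 := by
        have := congrArg (formalLength Fˣ) hsε
        simpa [map_multiset_sum, formalLength_single, mapFormalSums_single,
          Multiset.map_map, Function.comp_def] using this
      obtain ⟨x, y, rfl⟩ := Multiset.card_eq_two.1 hm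
      have hxy : (x : K) + y = 0 := by simpa [formalEval_single] using hs
      have hy : y = -1 * x := by
        ext
        push_cast
        linear_combination hxy
      subst hy
      have h2 : MonoidAlgebra.single (Units.map (φ : K →* F) x) (1 : ℕ)
            + MonoidAlgebra.single (Units.map (φ : K →* F) (-1 * x)) 1
          = MonoidAlgebra.single (1 : Fˣ) (1 : ℕ) + MonoidAlgebra.single ε 1 := by
        simpa [mapFormalSums_single] using hsε
      have hsq : Units.map (φ : K →* F) (-1) * Units.map (φ : K →* F) (-1) = 1 := by
        rw [← map_mul]; simp
      rw [MonoidAlgebra.single_add_single_inj one_ne_zero one_ne_zero] at h2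
      rcases h2 with ⟨h, h'⟩ | ⟨-, h, h'⟩ | ⟨h, -⟩
      · rw [← h', map_mul, h, mul_one]
      · rw [map_mul, h] at h'
        calc ε = (Units.map (φ : K →* F) (-1) * Units.map (φ : K →* F) (-1)) * ε := by
              rw [hsq, one_mul]
          _ = Units.map (φ : K →* F) (-1) := by rw [mul_assoc, h', mul_one]
      · exact absurd h (by norm_num)
  single_mul_mem := by
    rintro g _ ⟨s, hs, rfl⟩
    obtain ⟨x, hx⟩ := hφ g
    have hx0 : x ≠ 0 := by
      rintro rfl
      exact g.ne_zero (by rw [← hx, map_zero])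
    have hg : Units.map (φ : K →* F) (Units.mk0 x hx0) = g := by
      ext
      simpa using hx
    refine ⟨MonoidAlgebra.single (Units.mk0 x hx0) 1 * s, ?_, ?_⟩
    · simp only [Set.mem_ofPred_eq] at hs ⊢
      rw [map_mul, hs, mul_zero]
    · rw [map_mul, mapFormalSums_single, hg]

/-- A homomorphism of tracts. A homomorphism of monoids with zero between groups with zero is the
same as a map sending `0` to `0` that restricts to a homomorphism of the groups of units. -/
structure TractHom (G F : Type*) [CommGroupWithZero G] [CommGroupWithZero F]
    [Tract G] [Tract F] extends G →*₀ F where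
  map_nullSet : ∀ s ∈ Tract.nullSet (F := G),
    mapFormalSums toMonoidWithZeroHom s ∈ Tract.nullSet (F := F)

/-- An element of `F` as a formal sum; the element `0` is the empty sum. -/
noncomputable def toFormal {F : Type*} [CommGroupWithZero F] (x : F) : MonoidAlgebra ℕ Fˣ :=
  open Classical in if h : x = 0 then 0 else MonoidAlgebra.single (Units.mk0 x h) 1

theorem toFormal_zero {F : Type*} [CommGroupWithZero F] : toFormal (0 : F) = 0 := by
  simp [toFormal]

theorem toFormal_unit {F : Type*} [CommGroupWithZero F] (g : Fˣ) :
    toFormal (g : F) = MonoidAlgebra.single g 1 := by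
  simp [toFormal]

theorem toFormal_unit_mul {F : Type*} [CommGroupWithZero F] (g : Fˣ) (x : F) :
    toFormal ((g : F) * x) = MonoidAlgebra.single g 1 * toFormal x := by
  rcases eq_or_ne x 0 with rfl | hx
  · simp [toFormal_zero]
  · lift x to Fˣ using hx.isUnit
    rw [← Units.val_mul, toFormal_unit, toFormal_unit, MonoidAlgebra.single_mul_single, mul_one]

theorem mapFormalSums_toFormal {G F : Type*} [CommGroupWithZero G] [CommGroupWithZero F]
    (φ : G →*₀ F) (x : G) : mapFormalSums φ (toFormal x) = toFormal (φ x) := by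
  rcases eq_or_ne x 0 with rfl | hx
  · simp [toFormal_zero]
  · lift x to Gˣ using hx.isUnit
    rw [toFormal_unit, mapFormalSums_single, ← toFormal_unit]
    rfl

/-- Orthogonality of vectors over a tract: `∑ i, X i * Y i` lies in the null set. -/
def TractOrthogonal {F E : Type*} [CommGroupWithZero F] [Tract F] [Fintype E]
    (X Y : E → F) : Prop :=
  ∑ i, toFormal (X i * Y i) ∈ Tract.nullSet (F := F)

theorem TractOrthogonal.map {G F E : Type*} [CommGroupWithZero G] [CommGroupWithZero F]
    [Tract G] [Tract F] [Fintype E] {X Y : E → G} (h : TractOrthogonal X Y) (φ : TractHom G F) :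
    TractOrthogonal (fun i => φ.toMonoidWithZeroHom (X i))
      (fun i => φ.toMonoidWithZeroHom (Y i)) := by
  have := φ.map_nullSet _ h
  simpa only [TractOrthogonal, map_sum, mapFormalSums_toFormal, map_mul] using this

theorem TractOrthogonal.smul_smul {F E : Type*} [CommGroupWithZero F] [Tract F] [Fintype E]
    {X Y : E → F} (h : TractOrthogonal X Y) (c d : Fˣ) : TractOrthogonal (c • X) (d • Y) := by
  have := Tract.single_mul_mem (c * d) _ h
  rw [Finset.mul_sum] at this
  unfold TractOrthogonal
  convert this using 3 with i
  rw [← toFormal_unit_mul]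
  congr 1
  simp only [Pi.smul_apply, Units.smul_def, smul_eq_mul, Units.val_mul]
  exact mul_mul_mul_comm _ _ _ _

/-- A (strong) matroid over the tract `F` on the finite set `E`. -/
structure TractMatroid (F E : Type*) [CommGroupWithZero F] [Tract F] [Fintype E] where
  underlying : Matroid E
  ground_eq : underlying.E = Set.univ
  circuits : Set (E → F)
  cocircuits : Set (E → F)
  smul_mem_circuits : ∀ (c : Fˣ), ∀ X ∈ circuits, c • X ∈ circuits
  smul_mem_cocircuits : ∀ (c : Fˣ), ∀ X ∈ cocircuits, c • X ∈ cocircuits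
  isCircuit_support : ∀ X ∈ circuits, underlying.IsCircuit (Function.support X)
  isCocircuit_support : ∀ X ∈ cocircuits, underlying.IsCocircuit (Function.support X)
  exists_circuit : ∀ C, underlying.IsCircuit C → ∃ X ∈ circuits, Function.support X = C
  exists_cocircuit : ∀ C, underlying.IsCocircuit C → ∃ X ∈ cocircuits, Function.support X = C
  circuit_unique : ∀ X ∈ circuits, ∀ Y ∈ circuits,
    Function.support X = Function.support Y → ∃ c : Fˣ, Y = c • X
  cocircuit_unique : ∀ X ∈ cocircuits, ∀ Y ∈ cocircuits,
    Function.support X = Function.support Y → ∃ c : Fˣ, Y = c • X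
  orthogonal : ∀ X ∈ circuits, ∀ Y ∈ cocircuits, TractOrthogonal X Y

/-- The vectors of a matroid over a tract. -/
def TractMatroid.vectors {F E : Type*} [CommGroupWithZero F] [Tract F] [Fintype E]
    (M : TractMatroid F E) : Set (E → F) :=
  {X | ∀ Y ∈ M.cocircuits, TractOrthogonal X Y}

/-- The covectors of a matroid over a tract. -/
def TractMatroid.covectors {F E : Type*} [CommGroupWithZero F] [Tract F] [Fintype E]
    (M : TractMatroid F E) : Set (E → F) :=
  {X | ∀ Y ∈ M.circuits, TractOrthogonal X Y}

/-- The set of all `c • φ(X)`, with `X` in the given set `S` and `c` a unit. -/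
def pushSet {G F E : Type*} [CommGroupWithZero G] [CommGroupWithZero F]
    (φ : G →*₀ F) (S : Set (E → G)) : Set (E → F) :=
  {Y | ∃ X ∈ S, ∃ c : Fˣ, Y = c • fun i => φ (X i)}

theorem support_smul_map {G F E : Type*} [CommGroupWithZero G] [CommGroupWithZero F]
    (φ : G →*₀ F) (X : E → G) (c : Fˣ) :
    Function.support (c • fun i => φ (X i)) = Function.support X := by
  ext i
  simp [Units.smul_def]

theorem pushSet_smul {G F E : Type*} [CommGroupWithZero G] [CommGroupWithZero F]
    (φ : G →*₀ F) (S : Set (E → G)) (c : Fˣ) (Y : E → F) (hY : Y ∈ pushSet φ S) :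
    c • Y ∈ pushSet φ S := by
  obtain ⟨X, hX, d, rfl⟩ := hY
  exact ⟨X, hX, c * d, by rw [mul_smul]⟩

theorem pushSet_unique {G F E : Type*} [CommGroupWithZero G] [CommGroupWithZero F]
    (φ : G →*₀ F) (S : Set (E → G))
    (hS : ∀ X ∈ S, ∀ Y ∈ S, Function.support X = Function.support Y → ∃ c : Gˣ, Y = c • X) :
    ∀ X ∈ pushSet φ S, ∀ Y ∈ pushSet φ S,
      Function.support X = Function.support Y → ∃ c : Fˣ, Y = c • X := by
  rintro _ ⟨X, hX, c, rfl⟩ _ ⟨Y, hY, d, rfl⟩ h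
  rw [support_smul_map, support_smul_map] at h
  obtain ⟨a, rfl⟩ := hS X hX Y hY h
  refine ⟨d * Units.map (φ : G →* F) a * c⁻¹, ?_⟩
  rw [smul_smul, inv_mul_cancel_right, mul_smul]
  congr 1
  ext i
  simp [Units.smul_def]

/-- The push-forward `φ_*(M)` of a matroid along a homomorphism of tracts. -/
def TractMatroid.pushforward {G F E : Type*} [CommGroupWithZero G] [CommGroupWithZero F]
    [Tract G] [Tract F] [Fintype E] (φ : TractHom G F) (M : TractMatroid G E) :
    TractMatroid F E where
  underlying := M.underlying
  ground_eq := M.ground_eq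
  circuits := pushSet φ.toMonoidWithZeroHom M.circuits
  cocircuits := pushSet φ.toMonoidWithZeroHom M.cocircuits
  smul_mem_circuits c X hX := pushSet_smul _ _ c X hX
  smul_mem_cocircuits c X hX := pushSet_smul _ _ c X hX
  isCircuit_support := by
    rintro _ ⟨X, hX, c, rfl⟩
    rw [support_smul_map]
    exact M.isCircuit_support X hX
  isCocircuit_support := by
    rintro _ ⟨X, hX, c, rfl⟩
    rw [support_smul_map]
    exact M.isCocircuit_support X hX
  exists_circuit C hC := by
    obtain ⟨X, hX, rfl⟩ := M.exists_circuit C hC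
    exact ⟨_, ⟨X, hX, 1, rfl⟩, support_smul_map _ _ _⟩
  exists_cocircuit C hC := by
    obtain ⟨X, hX, rfl⟩ := M.exists_cocircuit C hC
    exact ⟨_, ⟨X, hX, 1, rfl⟩, support_smul_map _ _ _⟩
  circuit_unique := pushSet_unique _ _ M.circuit_unique
  cocircuit_unique := pushSet_unique _ _ M.cocircuit_unique
  orthogonal := by
    rintro _ ⟨X, hX, c, rfl⟩ _ ⟨Y, hY, d, rfl⟩
    exact ((M.orthogonal X hX Y hY).map φ).smul_smul c d

theorem TractOrthogonal.map_pushSet {G F E : Type*} [CommGroupWithZero G] [CommGroupWithZero F]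
    [Tract G] [Tract F] [Fintype E] (φ : TractHom G F) {S : Set (E → G)} {X : E → G}
    (hX : ∀ Y ∈ S, TractOrthogonal X Y) :
    ∀ Y ∈ pushSet φ.toMonoidWithZeroHom S,
      TractOrthogonal (fun i => φ.toMonoidWithZeroHom (X i)) Y := by
  rintro _ ⟨Y, hY, c, rfl⟩
  have := ((hX Y hY).map φ).smul_smul 1 c
  rwa [one_smul] at this

/-- The natural map from the vectors of `M` to the vectors of `φ_*(M)`. -/
def TractMatroid.vectorMap {G F E : Type*} [CommGroupWithZero G] [CommGroupWithZero F]
    [Tract G] [Tract F] [Fintype E] (φ : TractHom G F) (M : TractMatroid G E)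
    (X : M.vectors) : (M.pushforward φ).vectors :=
  ⟨fun i => φ.toMonoidWithZeroHom (X.1 i), TractOrthogonal.map_pushSet φ X.2⟩

/-- A homomorphism `φ : G → F` of tracts is epic if for every `G`-matroid `M` on a finite set, the
natural map from the vectors of `M` to the vectors of `φ_*(M)` is surjective. -/
def TractHom.IsEpic {G F : Type*} [CommGroupWithZero G] [CommGroupWithZero F]
    [Tract G] [Tract F] (φ : TractHom G F) : Prop :=
  ∀ (E : Type u) [Fintype E] (M : TractMatroid G E), Function.Surjective (M.vectorMap φ)

theorem signHom_surjective : Function.Surjective (signHom : ℝ →*₀ SignType) := by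
  intro s
  refine ⟨(s : ℝ), ?_⟩
  cases s <;> simp [signHom]

/-- The sign hyperfield, the quotient of `ℝ` by the subgroup of positive reals: `signHom` is the
map `SignType.sign` from `ℝ` onto `{0, 1, -1}`, and its kernel on units is the group of positive
reals. -/
noncomputable instance signHyperfield : Tract SignType :=
  Tract.quotientHyperfield (signHom : ℝ →*₀ SignType) signHom_surjective

/-- The natural homomorphism of tracts from `ℝ` to the sign hyperfield. -/
noncomputable def signTractHom : TractHom ℝ SignType where
  toMonoidWithZeroHom := signHom
  map_nullSet s hs := ⟨s, hs, rfl⟩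

/-! For vectors of `M`, let `A` be the circuits, `B` the cocircuits, `V ⊇ B` the space orthogonal to
`A`, and `y` the real 0, ±1 vector of a sign vector `Y` orthogonal to all signs of `B`. A lift is
sought as `f * y` with `f` strictly positive: its signs are those of `Y`, and it is orthogonal to
`V` exactly when `f` is orthogonal to `V * y`. By separation (`Submodule.exists_pos_orthogonal`)
such an `f` exists unless some `W` in `V` makes `W * y` nonnegative and nonzero. The support of a
nonzero `W` in `V` contains a cocircuit, so elimination (`exists_mem_mul_nonneg`) turns `W` into
some `b` in `B` with the same property. Then `Y` times the signs of `b` has a term 1 and no term -1,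
so it is not null, a contradiction. Covectors follow by exchanging `A` and `B`. -/

theorem formalEval_toFormal {K : Type*} [Field K] (x : K) : formalEval K (toFormal x) = x := by
  rcases eq_or_ne x 0 with rfl | hx
  · simp [toFormal_zero]
  · lift x to Kˣ using hx.isUnit
    simp [toFormal_unit, formalEval_single]

/-! ### Orthogonality over a field and over the sign hyperfield -/

/-- Orthogonality over a field is the vanishing of the standard bilinear form. -/
theorem tractOrthogonal_field_iff {K E : Type*} [Field K] [Fintype E] (X Y : E → K) :
    TractOrthogonal X Y ↔ ∑ i, X i * Y i = 0 := by
  change formalEval K (∑ i, toFormal (X i * Y i)) = 0 ↔ _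
  simp only [map_sum, formalEval_toFormal]

/-- A null formal sum over the sign hyperfield without the term `-1` is zero. -/
theorem eq_zero_of_mem_nullSet_sign {s : MonoidAlgebra ℕ SignTypeˣ}
    (hs : s ∈ Tract.nullSet (F := SignType)) (h : s.coeff (-1) = 0) : s = 0 := by
  obtain ⟨t, ht, rfl⟩ := hs
  obtain ⟨m, rfl⟩ := exists_multiset_formalSum t
  simp only [Set.mem_ofPred_eq, map_multiset_sum, Multiset.map_map, Function.comp_def,
    formalEval_single, Nat.cast_one, one_mul] at ht
  -- A negative term would map to -1, and coefficients in `ℕ` cannot cancel.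
  have hpos : ∀ x ∈ m, 0 < (x : ℝ) := by
    intro x hx
    by_contra hneg
    have hlt : (x : ℝ) < 0 := lt_of_le_of_ne (not_lt.1 hneg) x.ne_zero
    obtain ⟨k, rfl⟩ := Multiset.exists_cons_of_mem hx
    have hu : Units.map ((signHom : ℝ →*₀ SignType) : ℝ →* SignType) x = -1 := by
      ext
      simp [signHom, hlt]
    rw [Multiset.map_cons, Multiset.sum_cons, map_add, mapFormalSums_single, hu] at h
    simp at h
  have hm : m = 0 := by
    by_contra hm
    obtain ⟨x, hx⟩ := Multiset.exists_mem_of_ne_zero hm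
    obtain ⟨k, rfl⟩ := Multiset.exists_cons_of_mem hx
    rw [Multiset.map_cons, Multiset.sum_cons] at ht
    have h1 := hpos x hx
    have h2 : 0 ≤ (k.map fun y : ℝˣ => (y : ℝ)).sum := by
      apply Multiset.sum_nonneg
      intro y hy
      obtain ⟨z, hz, rfl⟩ := Multiset.mem_map.1 hy
      exact (hpos z (Multiset.mem_cons_of_mem hz)).le
    linarith
  simp [hm]

/-- Orthogonal sign vectors whose coordinatewise product is nonnegative have disjoint supports. -/
theorem TractOrthogonal.sign_mul_eq_zero {E : Type*} [Fintype E] {X Y : E → SignType}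
    (h : TractOrthogonal X Y) (h0 : ∀ i, X i * Y i ≠ -1) (i : E) : X i * Y i = 0 := by
  have key := eq_zero_of_mem_nullSet_sign h (by
    rw [MonoidAlgebra.coeff_sum, Finsupp.finsetSum_apply]
    refine Finset.sum_eq_zero fun j _ => ?_
    rcases eq_or_ne (X j * Y j) 0 with hj | hj
    · simp [hj, toFormal_zero]
    · rw [toFormal, dif_neg hj, MonoidAlgebra.coeff_single, Finsupp.single_apply, if_neg]
      intro he
      exact h0 j (by simpa using congrArg Units.val he))
  by_contra hi
  have hl := congrArg (formalLength SignTypeˣ) key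
  rw [map_sum, map_zero, Finset.sum_eq_zero_iff] at hl
  have := hl i (Finset.mem_univ i)
  rw [toFormal, dif_neg hi, formalLength_single] at this
  exact one_ne_zero this

/-! ### Cocircuits inside supports -/

/-- A nonempty set meeting no circuit in exactly one element contains a cocircuit. -/
theorem Matroid.exists_isCocircuit_subset_of_inter_ne_singleton {E : Type*} (N : Matroid E)
    {S : Set E} (hSE : S ⊆ N.E) (hS : S.Nonempty)
    (h : ∀ C, N.IsCircuit C → ∀ e, C ∩ S ≠ {e}) : ∃ D ⊆ S, N.IsCocircuit D := by
  by_contra! hcon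
  have hco : N.Coindep S := by
    rw [Matroid.coindep_def]
    by_contra hdep
    obtain ⟨D, hDS, hD⟩ := ((Matroid.not_indep_iff (M := N✶) hSE).1 hdep).exists_isCircuit_subset
    exact hcon D hDS hD
  -- A base avoiding `S`: the fundamental circuit of `e ∈ S` lies in `B ∪ {e}`, so it meets `S` only
  -- in `e`.
  obtain ⟨B, hB, hBS⟩ := (Matroid.coindep_iff_exists hSE).1 hco
  obtain ⟨e, he⟩ := hS
  have heB : e ∉ B := fun hb => (hBS hb).2 he
  refine h _ (hB.fundCircuit_isCircuit (hSE he) heB) e ?_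
  ext x
  constructor
  · rintro ⟨hx, hxS⟩
    rcases N.fundCircuit_subset_insert e B hx with rfl | hxB
    · rfl
    · exact absurd hxS (hBS hxB).2
  · rintro rfl
    exact ⟨N.mem_fundCircuit _ _, he⟩

/-- A nonzero vector orthogonal to vectors supported on all the circuits of a matroid contains a
cocircuit in its support. -/
theorem Matroid.exists_isCocircuit_subset_support {K E : Type*} [Field K] [Fintype E]
    (N : Matroid E) (hN : N.E = Set.univ) {A : Set (E → K)}
    (hA : ∀ C, N.IsCircuit C → ∃ X ∈ A, Function.support X = C)
    {W : E → K} (hW : ∀ X ∈ A, ∑ i, X i * W i = 0) (hW0 : W ≠ 0) :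
    ∃ D ⊆ Function.support W, N.IsCocircuit D := by
  refine N.exists_isCocircuit_subset_of_inter_ne_singleton (by simp [hN])
    (Function.support_nonempty_iff.2 hW0) fun C hC e he => ?_
  obtain ⟨X, hX, rfl⟩ := hA C hC
  have hmem : e ∈ Function.support X ∩ Function.support W := by simp [he]
  -- With supports meeting only in `e`, the vanishing sum reduces to `X e * W e`.
  refine mul_ne_zero hmem.1 hmem.2 ?_
  rw [← hW X hX, eq_comm]
  refine Finset.sum_eq_single e (fun j _ hj => ?_) (by simp)
  by_contra hne
  have hj' : j ∈ Function.support X ∩ Function.support W :=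
    ⟨left_ne_zero_of_mul hne, right_ne_zero_of_mul hne⟩
  rw [he] at hj'
  exact hj hj'

/-! ### Separation and elimination -/

/-- A theorem of the alternative: a subspace of `ℝ^E` that contains no nonzero nonnegative vector
has a strictly positive vector in its orthogonal complement. -/
theorem Submodule.exists_pos_orthogonal {E : Type*} [Fintype E] (U : Submodule ℝ (E → ℝ))
    (hU : ∀ u ∈ U, (∀ i, 0 ≤ u i) → u = 0) :
    ∃ f : E → ℝ, (∀ i, 0 < f i) ∧ ∀ u ∈ U, ∑ i, f i * u i = 0 := by
  classical
  have hdisj : Disjoint (U : Set (E → ℝ)) (stdSimplex ℝ E) := by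
    rw [Set.disjoint_left]
    rintro u hu ⟨hnn, hsum⟩
    simp [hU u hu hnn] at hsum
  obtain ⟨f, a, b, hfU, hab, hfs⟩ := geometric_hahn_banach_closed_compact U.convex
    U.closed_of_finiteDimensional (convex_stdSimplex ℝ E) (isCompact_stdSimplex ℝ E) hdisj
  have ha : 0 < a := by simpa using hfU 0 U.zero_mem
  -- A linear functional bounded above on a subspace vanishes there: otherwise a multiple of `u`
  -- attains the excluded value `a`.
  have hzero : ∀ u ∈ U, f u = 0 := by
    intro u hu
    by_contra hne
    have h1 := hfU ((a / f u) • u) (U.smul_mem _ hu)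
    rw [map_smul, smul_eq_mul, div_mul_cancel₀ _ hne] at h1
    exact lt_irrefl _ h1
  refine ⟨fun i => f (Pi.single i 1), fun i => ?_, fun u hu => ?_⟩
  · exact ha.trans (hab.trans (hfs _ (single_mem_stdSimplex ℝ i)))
  · rw [← hzero u hu]
    conv_rhs => rw [pi_eq_sum_univ' u, map_sum]
    refine Finset.sum_congr rfl fun i _ => ?_
    rw [map_smul, smul_eq_mul, mul_comm]

/-- Let every nonzero vector of a subspace `V` of `ℝ^E` contain in its support that of a nonzero
element of `B ⊆ V`. If `V` has a vector whose product with `y` is nonnegative and nonzero, so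
does `B`, up to sign. -/
theorem exists_mem_mul_nonneg {E : Type*} [Fintype E] (V : Submodule ℝ (E → ℝ))
    {B : Set (E → ℝ)} (hBV : B ⊆ V) (hneg : ∀ b ∈ B, -b ∈ B)
    (hB : ∀ W ∈ V, W ≠ 0 → ∃ b ∈ B, b ≠ 0 ∧ Function.support b ⊆ Function.support W)
    (y : E → ℝ) (n : ℕ) : ∀ W ∈ V, (Function.support W).ncard ≤ n → (∀ i, 0 ≤ W i * y i) →
      (∃ i, W i * y i ≠ 0) → ∃ b ∈ B, (∀ i, 0 ≤ b i * y i) ∧ ∃ i, b i * y i ≠ 0 := by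
  classical
  induction n with
  | zero =>
    rintro W - hcard - ⟨i, hi⟩
    have h0 : Function.support W = ∅ :=
      (Set.ncard_eq_zero (Set.toFinite _)).1 (Nat.le_zero.1 hcard)
    exact absurd (by simp [Function.support_eq_empty_iff.1 h0]) hi
  | succ n ih =>
    rintro W hWV hcard hnn ⟨i, hi⟩
    have hreduce : ∀ b ∈ B, Function.support b ⊆ Function.support W → ∀ t : ℝ, ∀ e, b e ≠ 0 →
        W e = t * b e → Function.support (W - t • b) ⊂ Function.support W := by
      intro b _ hsub t e he hte
      refine (Set.ssubset_iff_of_subset fun j hj => ?_).2 ⟨e, hsub he, by simp [hte]⟩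
      by_contra hWj
      have hbj : b j = 0 := by
        by_contra hbj
        exact hWj (hsub hbj)
      exact hj (by simp [hbj, Function.notMem_support.1 hWj])
    have hstep : ∀ b ∈ B, Function.support b ⊆ Function.support W → ∀ t : ℝ, ∀ e, b e ≠ 0 →
        W e = t * b e → (∀ j, 0 ≤ (W j - t * b j) * y j) → (∃ j, (W j - t * b j) * y j ≠ 0) →
        ∃ b ∈ B, (∀ i, 0 ≤ b i * y i) ∧ ∃ i, b i * y i ≠ 0 := by
      intro b hb hsub t e he hte hnn' hex
      refine ih (W - t • b) (V.sub_mem hWV (V.smul_mem _ (hBV hb))) ?_ (by simpa using hnn')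
        (by simpa using hex)
      have := Set.ncard_lt_ncard (hreduce b hb hsub t e he hte) (Set.toFinite _)
      omega
    obtain ⟨b, hb, hb0, hsub⟩ := hB W hWV (by rintro rfl; simp at hi)
    -- If `b` vanishes wherever `y` does not, subtracting any multiple of `b` leaves `W * y`
    -- unchanged, so any coordinate of `b` may be cleared.
    by_cases hby : ∀ j, b j * y j = 0
    · obtain ⟨e, he⟩ := Function.ne_iff.1 hb0
      have hsame : ∀ j, (W j - W e / b e * b j) * y j = W j * y j := fun j => by
        linear_combination (-(W e / b e)) * hby j
      exact hstep b hb hsub (W e / b e) e he (div_mul_cancel₀ _ he).symm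
        (fun j => by rw [hsame]; exact hnn j) ⟨i, by rwa [hsame]⟩
    obtain ⟨b, hb, hsub, hpos⟩ : ∃ b ∈ B, Function.support b ⊆ Function.support W ∧
        ∃ j, 0 < b j * y j := by
      obtain ⟨j, hj⟩ := not_forall.1 hby
      rcases lt_or_gt_of_ne hj with hlt | hgt
      · exact ⟨-b, hneg b hb, by simpa using hsub, j, by simpa using hlt⟩
      · exact ⟨b, hb, hsub, j, hgt⟩
    by_cases hall : ∀ j, 0 ≤ b j * y j
    · exact ⟨b, hb, hall, hpos.imp fun _ => ne_of_gt⟩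
    obtain ⟨k, hk⟩ := not_forall.1 hall
    rw [not_le] at hk
    have hne : (Finset.univ.filter fun j => 0 < b j * y j).Nonempty := by
      obtain ⟨j, hj⟩ := hpos
      exact ⟨j, by simpa using hj⟩
    -- Ratio test: the minimum is the largest `t` for which `(W - t • b) * y` stays nonnegative, and
    -- it clears coordinate `e`. At `k`, where `b k * y k < 0`, the new product is strictly positive
    -- because `t > 0`.
    obtain ⟨e, he, hmin⟩ := Finset.exists_min_image _
      (fun j => (W j * y j) / (b j * y j)) hne
    simp only [Finset.mem_filter, Finset.mem_univ, true_and] at he hmin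
    set t := (W e * y e) / (b e * y e) with ht
    have hbe : b e ≠ 0 := left_ne_zero_of_mul he.ne'
    have hye : y e ≠ 0 := right_ne_zero_of_mul he.ne'
    have ht0 : 0 < t := by
      refine div_pos (lt_of_le_of_ne (hnn e) (Ne.symm ?_)) he
      exact mul_ne_zero (hsub hbe) hye
    refine hstep b hb hsub t e hbe (by rw [ht]; field_simp) (fun j => ?_) ⟨k, ?_⟩
    · rcases lt_or_ge 0 (b j * y j) with hj | hj
      · have := (le_div_iff₀ hj).1 (hmin j hj)
        linarith
      · have := mul_nonpos_of_nonneg_of_nonpos ht0.le hj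
        nlinarith [hnn j]
    · have := mul_neg_of_pos_of_neg ht0 hk
      have h1 := hnn k
      refine ne_of_gt ?_
      linarith

/-! ### Lifting sign vectors -/

/-- Let `A` and `B` be orthogonal sets of real vectors such that every nonzero vector orthogonal to
`A` contains in its support that of a nonzero element of `B`. Then every sign vector orthogonal to
the signs of `B` is the sign vector of a real vector orthogonal to `B`. -/
theorem exists_sign_eq_of_orthogonal {E : Type*} [Fintype E] {A B : Set (E → ℝ)}
    (hAB : ∀ a ∈ A, ∀ b ∈ B, ∑ i, a i * b i = 0) (hneg : ∀ b ∈ B, -b ∈ B)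
    (hB : ∀ W : E → ℝ, (∀ a ∈ A, ∑ i, a i * W i = 0) → W ≠ 0 →
      ∃ b ∈ B, b ≠ 0 ∧ Function.support b ⊆ Function.support W)
    (Y : E → SignType) (hY : ∀ b ∈ B, TractOrthogonal Y fun i => SignType.sign (b i)) :
    ∃ X : E → ℝ, (∀ b ∈ B, ∑ i, X i * b i = 0) ∧ ∀ i, Y i = SignType.sign (X i) := by
  let V : Submodule ℝ (E → ℝ) :=
    { carrier := {W | ∀ a ∈ A, ∑ i, a i * W i = 0}
      zero_mem' := by simp
      add_mem' := fun {v w} hv hw a ha => by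
        simp only [Pi.add_apply, mul_add, Finset.sum_add_distrib, hv a ha, hw a ha, add_zero]
      smul_mem' := fun c v hv a ha => by
        simp only [Pi.smul_apply, smul_eq_mul, mul_left_comm _ c, ← Finset.mul_sum, hv a ha,
          mul_zero] }
  let y : E → ℝ := fun i => (Y i : ℝ)
  let D : (E → ℝ) →ₗ[ℝ] (E → ℝ) := LinearMap.mulRight ℝ y
  obtain ⟨f, hf, hfV⟩ := Submodule.exists_pos_orthogonal (V.map D) (by
    rintro _ ⟨W, hW, rfl⟩ hnn
    by_contra hne
    obtain ⟨j, hj⟩ := Function.ne_iff.1 hne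
    obtain ⟨b, hb, hbnn, i, hi⟩ := exists_mem_mul_nonneg V (fun b hb a ha => hAB a ha b hb) hneg
      hB y _ W hW le_rfl hnn ⟨j, hj⟩
    have hsign : ∀ i, Y i * SignType.sign (b i) = SignType.sign (b i * y i) := fun i => by
      rw [sign_mul, mul_comm]
      congr 1
      cases h : Y i <;> simp [y, h]
    -- No product of `Y` with the sign of `b` is -1, so orthogonality forces all of them to vanish,
    -- against `hi`.
    refine hi (sign_eq_zero_iff.1 ?_)
    rw [← hsign]
    refine (hY b hb).sign_mul_eq_zero (fun k hk => ?_) i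
    rw [hsign, sign_eq_neg_one_iff] at hk
    exact absurd (hbnn k) (not_le.2 hk))
  refine ⟨fun i => f i * y i, fun b hb => ?_, fun i => ?_⟩
  · rw [← hfV _ ⟨b, fun a ha => hAB a ha b hb, rfl⟩]
    refine Finset.sum_congr rfl fun i _ => ?_
    simp only [D, LinearMap.mulRight_apply, Pi.mul_apply]
    ring
  · rw [sign_mul, sign_pos (hf i), one_mul]
    cases h : Y i <;> simp [y, h]

theorem mem_pushSet_sign {E : Type*} {S : Set (E → ℝ)} {b : E → ℝ} (hb : b ∈ S) :
    (fun i => SignType.sign (b i)) ∈ pushSet signTractHom.toMonoidWithZeroHom S :=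
  ⟨b, hb, 1, by rw [one_smul]; rfl⟩

theorem neg_mem_of_units_smul_mem {E : Type*} {S : Set (E → ℝ)}
    (hS : ∀ (c : ℝˣ), ∀ X ∈ S, c • X ∈ S) : ∀ b ∈ S, -b ∈ S := by
  intro b hb
  have := hS (-1) b hb
  rwa [Units.neg_smul, one_smul] at this

/-- Every vector of the oriented matroid of a real matroid is the sign vector of a real vector. -/
theorem TractMatroid.exists_vector_sign_eq {E : Type*} [Fintype E] (M : TractMatroid ℝ E)
    {Y : E → SignType} (hY : Y ∈ (M.pushforward signTractHom).vectors) :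
    ∃ X ∈ M.vectors, ∀ i, Y i = SignType.sign (X i) := by
  obtain ⟨X, hX, hXY⟩ := exists_sign_eq_of_orthogonal (A := M.circuits) (B := M.cocircuits)
    (fun a ha b hb => (tractOrthogonal_field_iff _ _).1 (M.orthogonal a ha b hb))
    (neg_mem_of_units_smul_mem M.smul_mem_cocircuits)
    (fun W hW hW0 => by
      obtain ⟨D, hDW, hD⟩ :=
        M.underlying.exists_isCocircuit_subset_support M.ground_eq M.exists_circuit hW hW0
      obtain ⟨b, hb, rfl⟩ := M.exists_cocircuit D hD
      exact ⟨b, hb, Function.support_nonempty_iff.1 hD.nonempty, hDW⟩)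
    Y (fun b hb => hY _ (mem_pushSet_sign hb))
  exact ⟨X, fun b hb => (tractOrthogonal_field_iff _ _).2 (hX b hb), hXY⟩

/-- Every covector of the oriented matroid of a real matroid is the sign vector of a real
covector. -/
theorem TractMatroid.exists_covector_sign_eq {E : Type*} [Fintype E] (M : TractMatroid ℝ E)
    {Y : E → SignType} (hY : Y ∈ (M.pushforward signTractHom).covectors) :
    ∃ X ∈ M.covectors, ∀ i, Y i = SignType.sign (X i) := by
  obtain ⟨X, hX, hXY⟩ := exists_sign_eq_of_orthogonal (A := M.cocircuits) (B := M.circuits)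
    (fun a ha b hb => by
      simpa only [mul_comm] using (tractOrthogonal_field_iff _ _).1 (M.orthogonal b hb a ha))
    (neg_mem_of_units_smul_mem M.smul_mem_circuits)
    (fun W hW hW0 => by
      -- In the dual matroid the cocircuits of `M` play the role of circuits, and the cocircuit
      -- found is a circuit of `M`.
      obtain ⟨D, hDW, hD⟩ := M.underlying✶.exists_isCocircuit_subset_support
        (by rw [Matroid.dual_ground, M.ground_eq]) M.exists_cocircuit hW hW0
      rw [Matroid.dual_isCocircuit_iff] at hD
      obtain ⟨b, hb, rfl⟩ := M.exists_circuit D hD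
      exact ⟨b, hb, Function.support_nonempty_iff.1 hD.nonempty, hDW⟩)
    Y (fun b hb => hY _ (mem_pushSet_sign hb))
  exact ⟨X, fun b hb => (tractOrthogonal_field_iff _ _).2 (hX b hb), hXY⟩

theorem mainTheorem6 :
    TractHom.IsEpic.{u} signTractHom ∧
    ∀ (E : Type u) [Fintype E] (M : TractMatroid ℝ E),
      ∀ Y ∈ (M.pushforward signTractHom).covectors,
        ∃ X ∈ M.covectors, ∀ i, Y i = SignType.sign (X i) := by
  refine ⟨fun E _ M Y => ?_, fun E _ M Y hY => M.exists_covector_sign_eq hY⟩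
  obtain ⟨X, hX, hXY⟩ := M.exists_vector_sign_eq Y.2
  exact ⟨⟨X, hX⟩, Subtype.ext (funext fun i => (hXY i).symm)⟩
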